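/- Let $R$ be any ring (with unit, not necessarily commutative) and work with simplicial sets as spaces. A pro-space is a diagram $X=(X_s)_{s\in I}$ of simplicial sets indexed by a small cofiltered category $I$, and maps of pro-spaces (and of pro-objects of any category $\mathcal C$) are given by $\operatorname{Hom}_{\text{pro-}\mathcal C}(X,Y)=\lim_s\operatorname{colim}_t\operatorname{Hom}_{\mathcal C}(X_t,Y_s)$. For a pro-space $X$ and $n\ge 0$, let $H_n(X;R)$ be the pro-abelian group $(H_n(X_s;R))_s$, and for an $R$-module $M$ let $H^n(X;M)=\operatorname{colim}_s H^n(X_s;M)$. Let $f:X\to Y$ be a map of pro-spaces. Then $f$ is an $R$-homology weak equivalence, that is, the induced map $H_n(X;R)\to H_n(Y;R)$ is an isomorphism of pro-(abelian) groups for every $n\ge 0$, if and only if the induced map $f^*:H^n(Y;M)\to H^n(X;M)$ is an isomorphism for every $n\ge 0$ and every $R$-module $M$. -/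

import Mathlib

open CategoryTheory CategoryTheory.Limits Opposite

universe w v u v' u'

/-- A pro-object of `C`: a diagram in `C` indexed by a small cofiltered category. -/
structure ProObject (C : Type u) [Category.{v} C] where
  Index : Type w
  [smallCategory : SmallCategory Index]
  [isCofiltered : IsCofiltered Index]
  diagram : Index ⥤ C

namespace ProObject

attribute [instance] ProObject.smallCategory ProObject.isCofiltered

section

variable {C : Type u} [Category.{v} C] {D : Type u'} [Category.{v'} D]

/-- Two maps `X_t ⟶ c` and `X_t' ⟶ c` are identified in `colim_t Hom(X_t, c)` if and only if they
agree after restriction to some common `t''`. -/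
def germSetoid (X : ProObject.{w} C) (c : C) : Setoid (Σ t : X.Index, X.diagram.obj t ⟶ c) where
  r p q := ∃ (t : X.Index) (a : t ⟶ p.1) (b : t ⟶ q.1),
    X.diagram.map a ≫ p.2 = X.diagram.map b ≫ q.2
  iseqv :=
    { refl := fun p => ⟨p.1, 𝟙 _, 𝟙 _, rfl⟩
      symm := fun ⟨t, a, b, h⟩ => ⟨t, b, a, h.symm⟩
      trans := by
        rintro p q r ⟨t, a, b, h⟩ ⟨t', a', b', h'⟩
        obtain ⟨s, k, l, hkl⟩ := IsCofiltered.cospan b a'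
        refine ⟨s, k ≫ a, l ≫ b', ?_⟩
        rw [Functor.map_comp, Category.assoc, h, ← Category.assoc, ← Functor.map_comp, hkl,
          Functor.map_comp, Category.assoc, h', Functor.map_comp, Category.assoc] }

/-- The filtered colimit `colim_t Hom_C(X_t, c)`. -/
def Germ (X : ProObject.{w} C) (c : C) : Type (max w v) := Quotient (X.germSetoid c)

/-- The class in `colim_t Hom_C(X_t, c)` of a map `X_t ⟶ c`. -/
def germ (X : ProObject.{w} C) {c : C} {t : X.Index} (g : X.diagram.obj t ⟶ c) : X.Germ c :=
  Quotient.mk (X.germSetoid c) ⟨t, g⟩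

theorem germ_ind (X : ProObject.{w} C) {c : C} {p : X.Germ c → Prop}
    (h : ∀ (t : X.Index) (g : X.diagram.obj t ⟶ c), p (X.germ g)) (e : X.Germ c) : p e :=
  Quotient.ind (fun q => h q.1 q.2) e

theorem germ_eq_iff (X : ProObject.{w} C) {c : C} {t t' : X.Index}
    (g : X.diagram.obj t ⟶ c) (g' : X.diagram.obj t' ⟶ c) :
    X.germ g = X.germ g' ↔ ∃ (s : X.Index) (a : s ⟶ t) (b : s ⟶ t'),
      X.diagram.map a ≫ g = X.diagram.map b ≫ g' :=
  Quotient.eq (r := X.germSetoid c)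

theorem germ_map (X : ProObject.{w} C) {c : C} {s t : X.Index} (a : s ⟶ t)
    (g : X.diagram.obj t ⟶ c) : X.germ (X.diagram.map a ≫ g) = X.germ g :=
  (X.germ_eq_iff _ _).2 ⟨s, 𝟙 s, a, by simp⟩

/-- Composition with `h : c ⟶ d`, as a map `colim_t Hom(X_t, c) → colim_t Hom(X_t, d)`. -/
def Germ.post {X : ProObject.{w} C} {c d : C} (e : X.Germ c) (h : c ⟶ d) : X.Germ d :=
  Quotient.lift (fun p : Σ t : X.Index, X.diagram.obj t ⟶ c => X.germ (p.2 ≫ h))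
    (by
      rintro p q ⟨t, a, b, hab⟩
      refine (X.germ_eq_iff _ _).2 ⟨t, a, b, ?_⟩
      rw [← Category.assoc, hab, Category.assoc]) e

@[simp]
theorem germ_post (X : ProObject.{w} C) {c d : C} {t : X.Index} (g : X.diagram.obj t ⟶ c)
    (h : c ⟶ d) : (X.germ g).post h = X.germ (g ≫ h) := rfl

theorem Germ.post_post {X : ProObject.{w} C} {c d c' : C} (e : X.Germ c) (h : c ⟶ d)
    (k : d ⟶ c') : (e.post h).post k = e.post (h ≫ k) := by
  induction e using germ_ind with
  | h t g => simp

/-- A morphism of pro-objects: an element of `lim_s colim_t Hom_C(X_t, Y_s)`, that is, a compatible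
family of elements of the colimits `colim_t Hom_C(X_t, Y_s)`. -/
@[ext]
structure Hom (X Y : ProObject.{w} C) where
  app : ∀ s : Y.Index, X.Germ (Y.diagram.obj s)
  compatible : ∀ {s s' : Y.Index} (a : s ⟶ s'), (app s).post (Y.diagram.map a) = app s'

/-- Precomposition with a morphism of pro-objects, as a map
`colim_s Hom(Y_s, c) → colim_t Hom(X_t, c)`. The class of `g : Y_s ⟶ c` is sent to the class
of `X_t ⟶ Y_s ⟶ c`, where `X_t ⟶ Y_s` is a representative of the component `φ.app s`. -/
def Hom.pull {X Y : ProObject.{w} C} (φ : Hom X Y) {c : C} (e : Y.Germ c) : X.Germ c :=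
  Quotient.lift (fun p : Σ s : Y.Index, Y.diagram.obj s ⟶ c => (φ.app p.1).post p.2)
    (by
      rintro p q ⟨t, a, b, hab⟩
      rw [← φ.compatible a, ← φ.compatible b, Germ.post_post, Germ.post_post, hab]) e

@[simp]
theorem Hom.pull_germ {X Y : ProObject.{w} C} (φ : Hom X Y) {c : C} {s : Y.Index}
    (g : Y.diagram.obj s ⟶ c) : φ.pull (Y.germ g) = (φ.app s).post g := rfl

theorem Hom.pull_post {X Y : ProObject.{w} C} (φ : Hom X Y) {c d : C} (e : Y.Germ c)
    (h : c ⟶ d) : φ.pull (e.post h) = (φ.pull e).post h := by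
  induction e using germ_ind with
  | h t g => simp [Germ.post_post]

/-- The identity of a pro-object. -/
def Hom.id (X : ProObject.{w} C) : Hom X X where
  app s := X.germ (𝟙 (X.diagram.obj s))
  compatible a := by
    rw [germ_post, Category.id_comp, ← X.germ_map a (𝟙 _), Category.comp_id]

/-- The composition of morphisms of pro-objects. -/
def Hom.comp {X Y Z : ProObject.{w} C} (φ : Hom X Y) (ψ : Hom Y Z) : Hom X Z where
  app s := φ.pull (ψ.app s)
  compatible a := by rw [← Hom.pull_post, ψ.compatible]

theorem Hom.pull_id (X : ProObject.{w} C) {c : C} (e : X.Germ c) : (Hom.id X).pull e = e := by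
  induction e using germ_ind with
  | h t g => simp [Hom.id]

theorem Hom.pull_comp {X Y Z : ProObject.{w} C} (φ : Hom X Y) (ψ : Hom Y Z) {c : C}
    (e : Z.Germ c) : (φ.comp ψ).pull e = φ.pull (ψ.pull e) := by
  induction e using germ_ind with
  | h t g => simp [Hom.comp, Hom.pull_post]

/-- The category of pro-objects of `C`. -/
instance : Category (ProObject.{w} C) where
  Hom X Y := Hom X Y
  id X := Hom.id X
  comp φ ψ := Hom.comp φ ψ
  id_comp φ := Hom.ext (funext fun _ => Hom.pull_id _ _)
  comp_id φ := Hom.ext (funext fun s => by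
    change (φ.app s).post (𝟙 _) = φ.app s
    induction φ.app s using germ_ind with
    | h t g => simp)
  assoc φ ψ χ := Hom.ext (funext fun s => Hom.pull_comp φ ψ (χ.app s))

/-- The image under a functor `F` of an element of `colim_t Hom(X_t, c)`. -/
def Germ.map {X : ProObject.{w} C} {c : C} (F : C ⥤ D) (e : X.Germ c) :
    (ProObject.mk.{w} X.Index (X.diagram ⋙ F)).Germ (F.obj c) :=
  Quotient.lift (fun p : Σ t : X.Index, X.diagram.obj t ⟶ c =>
      (ProObject.mk.{w} X.Index (X.diagram ⋙ F)).germ (t := p.1) (F.map p.2))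
    (by
      rintro p q ⟨t, a, b, hab⟩
      refine (germ_eq_iff _ _ _).2 ⟨t, a, b, ?_⟩
      change F.map _ ≫ F.map _ = F.map _ ≫ F.map _
      rw [← F.map_comp, ← F.map_comp, hab]) e

theorem Germ.map_post {X : ProObject.{w} C} {c d : C} (F : C ⥤ D) (e : X.Germ c) (h : c ⟶ d) :
    (e.post h).map F = (e.map F).post (F.map h) := by
  induction e using germ_ind with
  | h t g =>
    exact congrArg (fun k => germ (ProObject.mk.{w} X.Index (X.diagram ⋙ F)) (t := t) k)
      (F.map_comp g h)

/-- The functor on pro-objects that applies a functor `F` levelwise. -/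
def mapPro (F : C ⥤ D) : ProObject.{w} C ⥤ ProObject.{w} D where
  obj X := ProObject.mk.{w} X.Index (X.diagram ⋙ F)
  map {X Y} φ :=
    { app := fun s => (Hom.app φ s).map F
      compatible := fun {s s'} a => by
        change ((Hom.app φ s).map F).post (F.map (Y.diagram.map a)) = _
        rw [← Germ.map_post, Hom.compatible φ a] }
  map_id X := Hom.ext (funext fun s => congrArg
    (fun k => germ (ProObject.mk.{w} X.Index (X.diagram ⋙ F)) (t := s) k) (F.map_id _))
  map_comp {X Y Z} φ ψ := Hom.ext (funext fun s => by
    change (Hom.pull φ (Hom.app ψ s)).map F = Hom.pull _ ((Hom.app ψ s).map F)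
    induction Hom.app ψ s using germ_ind with
    | h t g => exact Germ.map_post F (Hom.app φ t) g)

end

section

variable {C : Type u} [Category.{v} C] {E : Type u'} [Category.{v'} E]
  [HasColimitsOfSize.{w, w} E] (G : Cᵒᵖ ⥤ E)

/-- An element of `colim_t Hom(X_t, c)` represented by `g : X_t ⟶ c` induces the composite
`G(c) ⟶ G(X_t) ⟶ colim_t G(X_t)` for every contravariant functor `G`. -/
noncomputable def Germ.toColimit {X : ProObject.{w} C} {c : C} (e : X.Germ c) :
    G.obj (op c) ⟶ colimit (X.diagram.op ⋙ G) :=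
  Quotient.lift (fun p : Σ t : X.Index, X.diagram.obj t ⟶ c =>
      G.map p.2.op ≫ colimit.ι (X.diagram.op ⋙ G) (op p.1))
    (by
      rintro p q ⟨t, a, b, hab⟩
      change G.map p.2.op ≫ colimit.ι (X.diagram.op ⋙ G) (op p.1) =
        G.map q.2.op ≫ colimit.ι (X.diagram.op ⋙ G) (op q.1)
      rw [← colimit.w (X.diagram.op ⋙ G) a.op, ← colimit.w (X.diagram.op ⋙ G) b.op]
      change G.map p.2.op ≫ G.map (X.diagram.map a).op ≫ _ =
        G.map q.2.op ≫ G.map (X.diagram.map b).op ≫ _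
      rw [← Category.assoc, ← Category.assoc, ← G.map_comp, ← G.map_comp, ← op_comp, ← op_comp,
        hab]) e

theorem Germ.toColimit_post {X : ProObject.{w} C} {c d : C} (e : X.Germ c) (h : c ⟶ d) :
    (e.post h).toColimit G = G.map h.op ≫ e.toColimit G := by
  induction e using germ_ind with
  | h t g =>
    change G.map (g ≫ h).op ≫ _ = G.map h.op ≫ G.map g.op ≫ _
    rw [op_comp, G.map_comp, Category.assoc]

/-- The map `colim_s G(Y_s) ⟶ colim_t G(X_t)` induced by a morphism `φ : X ⟶ Y` of pro-objects. -/
noncomputable def Hom.colimitMap {X Y : ProObject.{w} C} (φ : Hom X Y) :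
    colimit (Y.diagram.op ⋙ G) ⟶ colimit (X.diagram.op ⋙ G) :=
  colimit.desc (Y.diagram.op ⋙ G)
    { pt := colimit (X.diagram.op ⋙ G)
      ι :=
        { app := fun s => (φ.app s.unop).toColimit G
          naturality := fun s s' a => by
            change G.map (Y.diagram.map a.unop).op ≫ (φ.app s'.unop).toColimit G =
              (φ.app s.unop).toColimit G ≫ 𝟙 _
            rw [Category.comp_id, ← φ.compatible a.unop, Germ.toColimit_post] } }

theorem Germ.toColimit_colimitMap {X Y : ProObject.{w} C} (φ : Hom X Y) {c : C} (e : Y.Germ c) :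
    e.toColimit G ≫ φ.colimitMap G = (φ.pull e).toColimit G := by
  induction e using germ_ind with
  | h t g =>
    rw [Hom.pull_germ, Germ.toColimit_post]
    change (G.map g.op ≫ colimit.ι (Y.diagram.op ⋙ G) (op t)) ≫ φ.colimitMap G = _
    rw [Category.assoc, Hom.colimitMap, colimit.ι_desc]

/-- The extension of a contravariant functor `G` to pro-objects by `X ↦ colim_s G(X_s)`. -/
noncomputable def colimitFunctor : (ProObject.{w} C)ᵒᵖ ⥤ E where
  obj X := colimit (X.unop.diagram.op ⋙ G)
  map φ := Hom.colimitMap G φ.unop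
  map_id X := by
    refine colimit.hom_ext fun s => ?_
    rw [Hom.colimitMap, colimit.ι_desc]
    rw [Category.comp_id]
    change G.map (𝟙 (X.unop.diagram.obj s.unop)).op ≫ colimit.ι (X.unop.diagram.op ⋙ G) s = _
    rw [op_id, G.map_id, Category.id_comp]
  map_comp {X Y Z} φ ψ := by
    refine colimit.hom_ext fun s => ?_
    rw [Hom.colimitMap, colimit.ι_desc, Hom.colimitMap, colimit.ι_desc_assoc]
    exact (Germ.toColimit_colimitMap G ψ.unop (Hom.app φ.unop s.unop)).symm

end

end ProObject

/-- The category of pro-spaces, where a space is a simplicial set. -/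
abbrev ProSpace : Type (u + 1) := ProObject.{u} SSet.{u}

section

variable (R : Type u) [Ring R]

/-- The abelian group `H_n(X; R)` of a simplicial set `X`, as a functor: the underlying group of the
homology of the complex `C_*(X; R)` of free `R`-modules on the simplices of `X`. -/
noncomputable def homologyGroup (n : ℕ) : SSet.{u} ⥤ AddCommGrpCat.{u} :=
  SSet.homologyFunctor (C := ModuleCat.{u} R) (ModuleCat.of R R) n ⋙
    forget₂ (ModuleCat.{u} R) AddCommGrpCat.{u}

/-- The pro-abelian group `H_n(X; R)` of a pro-space `X`, as a functor. -/
noncomputable def proHomology (n : ℕ) : ProSpace.{u} ⥤ ProObject.{u} AddCommGrpCat.{u} :=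
  ProObject.mapPro (homologyGroup R n)

variable {R}

/-- The cochain complex `C^*(X; M) = Hom_R(C_*(X; R), M)` of a simplicial set `X` with coefficients
in an `R`-module `M`, as a contravariant functor of `X`. -/
noncomputable def cochains (M : ModuleCat.{u} R) :
    SSet.{u}ᵒᵖ ⥤ CochainComplex AddCommGrpCat.{u} ℕ :=
  ((SSet.chainComplexFunctor (ModuleCat.{u} R)).obj (ModuleCat.of R R)).op ⋙
    HomologicalComplex.opFunctor (ModuleCat.{u} R) (ComplexShape.down ℕ) ⋙
      (preadditiveYoneda.obj M).mapHomologicalComplex (ComplexShape.up ℕ)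

/-- The cohomology group `H^n(X; M)` of a simplicial set `X`, as a contravariant functor. -/
noncomputable def cohomologyGroup (M : ModuleCat.{u} R) (n : ℕ) :
    SSet.{u}ᵒᵖ ⥤ AddCommGrpCat.{u} :=
  cochains M ⋙ HomologicalComplex.homologyFunctor AddCommGrpCat.{u} (ComplexShape.up ℕ) n

/-- The cohomology group `H^n(X; M) = colim_s H^n(X_s; M)` of a pro-space `X`, as a contravariant
functor. -/
noncomputable def proCohomology (M : ModuleCat.{u} R) (n : ℕ) :
    ProSpace.{u}ᵒᵖ ⥤ AddCommGrpCat.{u} :=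
  ProObject.colimitFunctor.{u} (cohomologyGroup M n)

variable (R)

/-- An `R`-homology weak equivalence: a map of pro-spaces that induces isomorphisms
`H_n(X; R) ⟶ H_n(Y; R)` of pro-groups for all `n ≥ 0`. -/
def IsHomologyWeakEquivalence {X Y : ProSpace.{u}} (f : X ⟶ Y) : Prop :=
  ∀ n : ℕ, IsIso ((proHomology R n).map f)

end

/-! By a Yoneda argument, a map `φ : X ⟶ Y` of pro-objects is invertible exactly when `colim
Hom(Y_s, c) → colim Hom(X_t, c)` is bijective for all `c`. In an abelian category both sides are
left exact in `c`, so it suffices to test the terms `I`, `J` of a copresentation `0 → c → I → J`.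
This is used twice. With `I`, `J` injective, only injective targets matter. With `I`, `J` coinduced
modules, a map of pro-modules is invertible once the underlying map of pro-groups is. For injective
`I`, the functor `Hom(-, I)` is exact, so `H^n(X; I) ≅ Hom(H_n(X; R), I)`. Hence `f` is an
`R`-homology weak equivalence iff it is an isomorphism on cohomology with injective coefficients.
Arbitrary `M` is reached by dimension shifting along `0 → M → I → I/M → 0`: the long exact sequences
survive filtered colimits, and the four lemmas give an induction on the degree. -/

namespace ProObject

/-! ### Detecting isomorphisms of pro-objects -/

section

variable {C : Type u} [Category.{v} C] {D : Type u'} [Category.{v'} D]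

/-- A morphism of pro-objects is an isomorphism if and only if it induces a bijection
`colim_s Hom(Y_s, c) → colim_t Hom(X_t, c)` for every `c`. -/
theorem isIso_iff_pull_bijective {X Y : ProObject.{w} C} (φ : X ⟶ Y) :
    IsIso φ ↔ ∀ c : C, Function.Bijective (Hom.pull φ : Y.Germ c → X.Germ c) := by
  constructor
  · intro _ c
    refine Function.bijective_iff_has_inverse.2 ⟨Hom.pull (inv φ), fun e => ?_, fun e => ?_⟩
    · rw [← Hom.pull_comp]
      exact (congrArg (fun ψ : Hom Y Y => ψ.pull e) (IsIso.inv_hom_id φ)).trans (Hom.pull_id Y e)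
    · rw [← Hom.pull_comp]
      exact (congrArg (fun ψ : Hom X X => ψ.pull e) (IsIso.hom_inv_id φ)).trans (Hom.pull_id X e)
  · intro h
    -- Yoneda: the components of the inverse are the preimages of the identity germs.
    choose g hg using fun s : X.Index => (h (X.diagram.obj s)).2 (X.germ (𝟙 _))
    let ψ : Hom Y X :=
      { app := g
        compatible := fun {s s'} a => (h _).1 (by
          rw [Hom.pull_post, hg, hg]
          exact (Hom.id X).compatible a) }
    have h₁ : φ ≫ (ψ : Y ⟶ X) = 𝟙 X := Hom.ext (funext hg)
    -- From `φ ≫ ψ ≫ φ = φ`, injectivity of the pullback cancels the first `φ`.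
    have h₂ : (ψ : Y ⟶ X) ≫ φ = 𝟙 Y := Hom.ext (funext fun s => (h _).1 (by
      have h₃ : (φ ≫ (ψ : Y ⟶ X)) ≫ φ = φ ≫ 𝟙 Y := by rw [h₁, Category.id_comp, Category.comp_id]
      rw [Category.assoc] at h₃
      exact congrArg (fun χ : Hom X Y => χ.app s) h₃))
    exact ⟨ψ, h₁, h₂⟩

theorem Germ.post_injective_of_mono {X : ProObject.{w} C} {c d : C} (i : c ⟶ d) [Mono i] :
    Function.Injective (fun e : X.Germ c => e.post i) := by
  intro e e' h
  induction e using germ_ind with | h t g => ?_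
  induction e' using germ_ind with | h t' g' => ?_
  obtain ⟨s, a, b, hab⟩ := (X.germ_eq_iff _ _).1 h
  refine (X.germ_eq_iff _ _).2 ⟨s, a, b, ?_⟩
  rwa [← cancel_mono i, Category.assoc, Category.assoc]

theorem germ_zero_eq [HasZeroMorphisms C] (X : ProObject.{w} C) (c : C) (t t' : X.Index) :
    X.germ (0 : X.diagram.obj t ⟶ c) = X.germ (0 : X.diagram.obj t' ⟶ c) :=
  (X.germ_eq_iff _ _).2 ⟨IsCofiltered.min t t', IsCofiltered.minToLeft _ _,
    IsCofiltered.minToRight _ _, by simp⟩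

theorem Germ.post_zero [HasZeroMorphisms C] {X : ProObject.{w} C} {c d : C} (e : X.Germ c)
    (t : X.Index) : e.post (0 : c ⟶ d) = X.germ (0 : X.diagram.obj t ⟶ d) := by
  induction e using germ_ind with | h t' g => ?_
  rw [germ_post, comp_zero, X.germ_zero_eq d t' t]

/-- Bijectivity of `colim_s Hom(Y_s, -) → colim_t Hom(X_t, -)` passes to kernels. -/
theorem pull_bijective_of_exact [Preadditive C] [Balanced C] {X Y : ProObject.{w} C}
    (φ : Hom X Y) (S : ShortComplex C) (hS : S.Exact) (_ : Mono S.f)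
    (h₂ : Function.Bijective (φ.pull : Y.Germ S.X₂ → X.Germ S.X₂))
    (h₃ : Function.Injective (φ.pull : Y.Germ S.X₃ → X.Germ S.X₃)) :
    Function.Bijective (φ.pull : Y.Germ S.X₁ → X.Germ S.X₁) := by
  constructor
  · intro e e' h
    refine Germ.post_injective_of_mono S.f (h₂.1 ?_)
    change φ.pull (e.post S.f) = φ.pull (e'.post S.f)
    rw [Hom.pull_post, Hom.pull_post, h]
  · intro e
    obtain ⟨y, hy⟩ := h₂.2 (e.post S.f)
    induction y using germ_ind with | h t g => ?_
    -- In `X` this class vanishes, since it comes from `S.X₁`. So it vanishes in `Y`, and `g`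
    -- restricted to some further stage lifts to the kernel.
    have h₀ : Y.germ (g ≫ S.g) = Y.germ (0 : Y.diagram.obj t ⟶ S.X₃) := by
      refine h₃ ?_
      obtain ⟨s⟩ := IsCofiltered.nonempty (C := X.Index)
      rw [← germ_post, Hom.pull_post, hy, Germ.post_post, S.zero, Hom.pull_germ,
        Germ.post_zero _ s, Germ.post_zero _ s]
    obtain ⟨s, a, b, hab⟩ := (Y.germ_eq_iff _ _).1 h₀
    rw [comp_zero, ← Category.assoc] at hab
    refine ⟨Y.germ (hS.lift _ hab), Germ.post_injective_of_mono S.f ?_⟩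
    change (φ.pull _).post S.f = e.post S.f
    rw [← Hom.pull_post, germ_post, hS.lift_f, germ_map, hy]

theorem pull_mapPro_map {X Y : ProObject.{w} C} (φ : X ⟶ Y) (F : C ⥤ D) {c : C} (e : Y.Germ c) :
    Hom.pull ((mapPro F).map φ) (e.map F) = (Hom.pull φ e).map F := by
  induction e using germ_ind with | h t g => ?_
  exact (Germ.map_post F (Hom.app φ t) g).symm

/-- For `F ⊣ G`, the bijection `colim_t Hom(X_t, G d) ≃ colim_t Hom(F X_t, d)`. -/
theorem Germ.map_post_counit_bijective {F : C ⥤ D} {G : D ⥤ C} (adj : F ⊣ G)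
    (X : ProObject.{w} C) (d : D) :
    Function.Bijective (fun e : X.Germ (G.obj d) => (e.map F).post (adj.counit.app d)) := by
  constructor
  · intro e e' h
    induction e using germ_ind with | h t g => ?_
    induction e' using germ_ind with | h t' g' => ?_
    obtain ⟨s, a, b, hab⟩ := (germ_eq_iff _ _ _).1 h
    refine (X.germ_eq_iff _ _).2 ⟨s, a, b, (adj.homEquiv _ _).symm.injective ?_⟩
    rw [adj.homEquiv_counit, adj.homEquiv_counit, F.map_comp, F.map_comp, Category.assoc,
      Category.assoc]
    exact hab
  · intro e
    induction e using germ_ind with | h t g => ?_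
    refine ⟨X.germ (adj.homEquiv _ _ g), congrArg (germ _ (t := t)) ?_⟩
    exact (adj.homEquiv_counit _ _ _).symm.trans ((adj.homEquiv _ _).symm_apply_apply g)

/-- The adjunction bijections on germs commute with pulling back along `φ` and along its image under
`F`. -/
theorem pull_bijective_of_adjunction {F : C ⥤ D} {G : D ⥤ C} (adj : F ⊣ G)
    {X Y : ProObject.{w} C} (φ : X ⟶ Y) (d : D)
    (h : Function.Bijective (Hom.pull ((mapPro F).map φ) (c := d))) :
    Function.Bijective (Hom.pull φ (c := G.obj d)) := by
  rw [← Function.Bijective.of_comp_iff' (Germ.map_post_counit_bijective adj X d)]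
  refine (iff_of_eq (congrArg Function.Bijective (funext fun e => ?_))).1
    (h.comp (Germ.map_post_counit_bijective adj Y d))
  exact Eq.symm <| (congrArg (fun k => Germ.post k _) (pull_mapPro_map φ F e).symm).trans
    (Hom.pull_post _ _ _).symm

/-- A faithful left adjoint functor on an abelian category reflects isomorphisms of
pro-objects. -/
theorem isIso_of_isIso_mapPro_map {C : Type u} [Category.{v} C] [Abelian C] (F : C ⥤ D)
    [F.IsLeftAdjoint] [F.Faithful] {X Y : ProObject.{w} C} (φ : X ⟶ Y)
    (_ : IsIso ((mapPro F).map φ)) : IsIso φ := by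
  have adj := Adjunction.ofIsLeftAdjoint F
  have h := fun d => pull_bijective_of_adjunction adj φ d
    ((isIso_iff_pull_bijective ((mapPro F).map φ)).1 inferInstance d)
  refine (isIso_iff_pull_bijective φ).2 fun c => ?_
  let i := adj.unit.app c
  -- Faithfulness of `F` makes the unit mono, so embedding the cokernel by its unit keeps the kernel
  -- of `p` equal to `c`. Both other terms now lie in the image of the right adjoint.
  let p := cokernel.π i ≫ adj.unit.app (cokernel i)
  have hS : (ShortComplex.mk i p (by simp [p])).Exact := by
    let ψ : ShortComplex.mk i (cokernel.π i) (by simp) ⟶ ShortComplex.mk i p (by simp [p]) :=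
      { τ₁ := 𝟙 _, τ₂ := 𝟙 _, τ₃ := adj.unit.app (cokernel i) }
    have : Epi ψ.τ₁ := inferInstanceAs (Epi (𝟙 _))
    have : IsIso ψ.τ₂ := inferInstanceAs (IsIso (𝟙 _))
    have : Mono ψ.τ₃ := inferInstanceAs (Mono (adj.unit.app (cokernel i)))
    exact (ShortComplex.exact_iff_of_epi_of_isIso_of_mono ψ).1 (ShortComplex.exact_cokernel i)
  exact pull_bijective_of_exact φ _ hS (inferInstanceAs (Mono (adj.unit.app c))) (h _) (h _).1

/-- If the category is abelian with enough injectives, then isomorphisms of pro-objects are detected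
by maps to injective objects. -/
theorem isIso_iff_pull_bijective_of_injective {C : Type u} [Category.{v} C] [Abelian C]
    [EnoughInjectives C] {X Y : ProObject.{w} C} (φ : X ⟶ Y) :
    IsIso φ ↔ ∀ (I : C) [Injective I], Function.Bijective (Hom.pull φ (c := I)) := by
  refine ⟨fun h I _ => (isIso_iff_pull_bijective φ).1 h I,
    fun h => (isIso_iff_pull_bijective φ).2 fun c => ?_⟩
  exact pull_bijective_of_exact φ _ (exact_f_d (Injective.ι c)) (Injective.ι_mono c) (h _) (h _).1

end

/-! ### Filtered colimits of contravariant functors -/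

section

variable {C : Type u} [Category.{v} C] {D : Type u'} [Category.{v'} D]

theorem toColimit_germ {E : Type*} [Category* E] [HasColimitsOfSize.{w, w} E] (G : Cᵒᵖ ⥤ E)
    (X : ProObject.{w} C) {c : C} {t : X.Index} (g : X.diagram.obj t ⟶ c) :
    (X.germ g).toColimit G = G.map g.op ≫ colimit.ι (X.diagram.op ⋙ G) (op t) := rfl

theorem ι_colimitMap {E : Type*} [Category* E] [HasColimitsOfSize.{w, w} E] (G : Cᵒᵖ ⥤ E)
    {X Y : ProObject.{w} C} (φ : Hom X Y) (s : Y.Index) :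
    colimit.ι (Y.diagram.op ⋙ G) (op s) ≫ φ.colimitMap G = (φ.app s).toColimit G :=
  colimit.ι_desc _ _

/-- A natural transformation induces a natural transformation between the extensions to
pro-objects. -/
noncomputable def colimitFunctorMap {E : Type*} [Category* E] [HasColimitsOfSize.{w, w} E]
    {G G' : Cᵒᵖ ⥤ E} (α : G ⟶ G') : colimitFunctor.{w} G ⟶ colimitFunctor.{w} G' where
  app X := colimMap (Functor.whiskerLeft X.unop.diagram.op α)
  naturality X Y φ := by
    refine colimit.hom_ext fun s => ?_
    change colimit.ι (X.unop.diagram.op ⋙ G) (op s.unop) ≫ Hom.colimitMap G φ.unop ≫ _ =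
      colimit.ι (X.unop.diagram.op ⋙ G) s ≫ _ ≫ Hom.colimitMap G' φ.unop
    rw [← Category.assoc, ι_colimitMap, ι_colimMap_assoc]
    change _ = α.app _ ≫ colimit.ι (X.unop.diagram.op ⋙ G') (op s.unop) ≫ _
    rw [ι_colimitMap]
    induction Hom.app φ.unop s.unop using germ_ind with | h t g => ?_
    rw [toColimit_germ, toColimit_germ, Category.assoc, ι_colimMap, ← Category.assoc,
      ← Category.assoc, ← α.naturality]
    rfl

instance {E : Type*} [Category* E] [HasColimitsOfSize.{w, w} E] {G G' : Cᵒᵖ ⥤ E} (α : G ⟶ G')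
    [IsIso α] : IsIso (colimitFunctorMap.{w} α) := by
  have (X : (ProObject.{w} C)ᵒᵖ) : IsIso ((colimitFunctorMap.{w} α).app X) :=
    (HasColimit.isoOfNatIso (Functor.isoWhiskerLeft X.unop.diagram.op (asIso α))).isIso_hom
  exact NatIso.isIso_of_isIso_app _

theorem isIso_colimitMap_iff_of_iso {E : Type*} [Category* E] [HasColimitsOfSize.{w, w} E]
    {G G' : Cᵒᵖ ⥤ E} (α : G ≅ G') {X Y : ProObject.{w} C} (φ : X ⟶ Y) :
    IsIso (Hom.colimitMap G φ) ↔ IsIso (Hom.colimitMap G' φ) :=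
  NatIso.isIso_map_iff (asIso (colimitFunctorMap.{w} α.hom)) φ.op

theorem colimitMap_mapPro_map {E : Type*} [Category* E] [HasColimitsOfSize.{w, w} E]
    (F : C ⥤ D) (G : Dᵒᵖ ⥤ E) {X Y : ProObject.{w} C} (φ : X ⟶ Y) :
    Hom.colimitMap G ((mapPro F).map φ) = Hom.colimitMap (F.op ⋙ G) φ := by
  refine colimit.hom_ext fun s => ?_
  refine (ι_colimitMap G ((mapPro F).map φ) s.unop).trans
    (Eq.trans ?_ (ι_colimitMap (F.op ⋙ G) φ s.unop).symm)
  change ((Hom.app φ s.unop).map F).toColimit G = _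
  induction Hom.app φ s.unop using germ_ind with | h t g => ?_
  rfl

/-- Filtered colimits of abelian groups are computed on underlying sets, which identifies the
colimit of the groups `Hom(X_t, c)` with `X.Germ c`. -/
theorem isIso_colimitMap_preadditiveYoneda_iff {C : Type u} [Category.{w} C] [Preadditive C]
    {X Y : ProObject.{w} C} (φ : X ⟶ Y) (c : C) :
    IsIso (Hom.colimitMap (preadditiveYoneda.obj c) φ) ↔
      Function.Bijective (Hom.pull φ (c := c)) := by
  let θ (X : ProObject.{w} C) (e : X.Germ c) :
      ToType (colimit (X.diagram.op ⋙ preadditiveYoneda.obj c)) :=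
    e.toColimit (preadditiveYoneda.obj c) (𝟙 c)
  have hθ' (X : ProObject.{w} C) {t : X.Index} (g : X.diagram.obj t ⟶ c) :
      θ X (X.germ g) = colimit.ι (X.diagram.op ⋙ preadditiveYoneda.obj c) (op t) g :=
    congrArg (colimit.ι (X.diagram.op ⋙ preadditiveYoneda.obj c) (op t)) (Category.comp_id g)
  have hθ (X : ProObject.{w} C) : Function.Bijective (θ X) := by
    constructor
    · intro e e' h
      induction e using germ_ind with | h t g => ?_
      induction e' using germ_ind with | h t' g' => ?_
      rw [hθ', hθ'] at h
      obtain ⟨s, a, b, hab⟩ := (Concrete.colimit_rep_eq_iff_exists _ _ _).1 h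
      exact (X.germ_eq_iff _ _).2 ⟨s.unop, a.unop, b.unop, hab⟩
    · intro x
      obtain ⟨t, g, rfl⟩ := Concrete.colimit_exists_rep _ x
      exact ⟨X.germ (t := t.unop) g, hθ' X (t := t.unop) g⟩
  rw [ConcreteCategory.isIso_iff_bijective,
    ← Function.Bijective.of_comp_iff _ (hθ Y), ← Function.Bijective.of_comp_iff' (hθ X)]
  refine iff_of_eq (congrArg _ (funext fun e => ?_))
  exact ConcreteCategory.congr_hom (Germ.toColimit_colimitMap (preadditiveYoneda.obj c) φ e) (𝟙 c)

variable {G G₁ G₂ G₃ : Cᵒᵖ ⥤ AddCommGrpCat.{w}}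

theorem colimitFunctorMap_app_ι (α : G ⟶ G₁) (X : (ProObject.{w} C)ᵒᵖ) (s : X.unop.Indexᵒᵖ)
    (x : G.obj (X.unop.diagram.op.obj s)) :
    (colimitFunctorMap.{w} α).app X (colimit.ι (X.unop.diagram.op ⋙ G) s x) =
      colimit.ι (X.unop.diagram.op ⋙ G₁) s (α.app _ x) :=
  ConcreteCategory.congr_hom (ι_colimMap (Functor.whiskerLeft X.unop.diagram.op α) s) x

theorem colimit_ι_eq_zero (X : ProObject.{w} C) (s : X.Indexᵒᵖ)
    (x : G.obj (X.diagram.op.obj s)) (h : colimit.ι (X.diagram.op ⋙ G) s x = 0) :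
    ∃ (t : X.Indexᵒᵖ) (a : s ⟶ t), G.map (X.diagram.op.map a) x = 0 := by
  rw [← map_zero (colimit.ι (X.diagram.op ⋙ G) s).hom] at h
  obtain ⟨t, a, b, hab⟩ := (Concrete.colimit_rep_eq_iff_exists _ _ _).1 h
  exact ⟨t, a, hab.trans (map_zero ((X.diagram.op ⋙ G).map b).hom)⟩

theorem colimitFunctorMap_exact (α : G₁ ⟶ G₂) (β : G₂ ⟶ G₃)
    (h : ∀ c, Function.Exact (α.app c) (β.app c)) (X : (ProObject.{w} C)ᵒᵖ) :
    Function.Exact ((colimitFunctorMap.{w} α).app X) ((colimitFunctorMap.{w} β).app X) := by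
  intro y
  constructor
  · intro hy
    obtain ⟨s, y, rfl⟩ := Concrete.colimit_exists_rep _ y
    rw [colimitFunctorMap_app_ι] at hy
    obtain ⟨t, a, ha⟩ := colimit_ι_eq_zero _ _ _ hy
    rw [← NatTrans.naturality_apply] at ha
    obtain ⟨x, hx⟩ := (h _ _).1 ha
    refine ⟨colimit.ι (X.unop.diagram.op ⋙ G₁) t x, ?_⟩
    rw [colimitFunctorMap_app_ι, hx]
    exact ConcreteCategory.congr_hom (colimit.w (X.unop.diagram.op ⋙ G₂) a) y
  · rintro ⟨x, rfl⟩
    obtain ⟨s, x, rfl⟩ := Concrete.colimit_exists_rep _ x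
    rw [colimitFunctorMap_app_ι, colimitFunctorMap_app_ι, (h _ _).2 ⟨x, rfl⟩]
    exact map_zero (colimit.ι (X.unop.diagram.op ⋙ G₃) s).hom

theorem colimitFunctorMap_injective (α : G₁ ⟶ G₂)
    (h : ∀ c, Function.Injective (α.app c)) (X : (ProObject.{w} C)ᵒᵖ) :
    Function.Injective ((colimitFunctorMap.{w} α).app X) := by
  refine (injective_iff_map_eq_zero ((colimitFunctorMap.{w} α).app X).hom).2 fun x hx => ?_
  obtain ⟨s, x, rfl⟩ := Concrete.colimit_exists_rep _ x
  replace hx : (colimitFunctorMap.{w} α).app X _ = 0 := hx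
  rw [colimitFunctorMap_app_ι] at hx
  obtain ⟨t, a, ha⟩ := colimit_ι_eq_zero _ _ _ hx
  rw [← NatTrans.naturality_apply] at ha
  have h₀ := h _ (ha.trans (map_zero (α.app _).hom).symm)
  rw [← colimit.w (X.unop.diagram.op ⋙ G₁) a]
  exact (congrArg (colimit.ι (X.unop.diagram.op ⋙ G₁) t) h₀).trans
    (map_zero (colimit.ι (X.unop.diagram.op ⋙ G₁) t).hom)

end

end ProObject

namespace ProObject

variable {C : Type u} [Category.{v} C] {D : Type u'} [Category.{v'} D]

theorem mapPro_comp_map {E : Type*} [Category* E] (F : C ⥤ D) (G : D ⥤ E) {X Y : ProObject.{w} C}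
    (φ : X ⟶ Y) : (mapPro (F ⋙ G)).map φ = (mapPro G).map ((mapPro F).map φ) :=
  Hom.ext (funext fun s => by
    change (Hom.app φ s).map (F ⋙ G) = ((Hom.app φ s).map F).map G
    induction Hom.app φ s using germ_ind with | h t g => ?_
    rfl)

end ProObject

/-! ### Pro-homology and cohomology with injective coefficients -/

section

variable (R : Type u) [Ring R]

/-- Forgetting to groups is restriction along `ℤ → R`, whose right adjoint is coextension `Hom_ℤ(R,
-)`, followed by the forgetful functor from `ℤ`-modules. -/
instance ModuleCat.isLeftAdjoint_forget₂_addCommGrpCat :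
    (forget₂ (ModuleCat.{u} R) AddCommGrpCat.{u}).IsLeftAdjoint := by
  have h₁ : (ModuleCat.restrictScalars.{u} (Int.castRingHom R)).IsLeftAdjoint :=
    (ModuleCat.restrictCoextendScalarsAdj.{u, 0, u} (Int.castRingHom R)).isLeftAdjoint
  have h₂ : (ModuleCat.restrictScalars.{u} (Int.castRingHom R) ⋙
    forget₂ (ModuleCat.{u} ℤ) AddCommGrpCat.{u}).IsLeftAdjoint := inferInstance
  exact h₂

/-- Passes from pro-groups to pro-modules, where homology can be tested against injective
`R`-modules. -/
theorem isHomologyWeakEquivalence_iff {X Y : ProSpace.{u}} (f : X ⟶ Y) :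
    IsHomologyWeakEquivalence R f ↔ ∀ n : ℕ, IsIso ((ProObject.mapPro
      (SSet.homologyFunctor (C := ModuleCat.{u} R) (ModuleCat.of R R) n)).map f) := by
  refine forall_congr' fun n => ?_
  change IsIso ((ProObject.mapPro (SSet.homologyFunctor (C := ModuleCat.{u} R) (ModuleCat.of R R) n
    ⋙ forget₂ (ModuleCat.{u} R) AddCommGrpCat.{u})).map f) ↔ _
  rw [ProObject.mapPro_comp_map]
  constructor
  · intro h
    exact ProObject.isIso_of_isIso_mapPro_map (forget₂ (ModuleCat.{u} R) AddCommGrpCat.{u}) _ h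
  · intro h
    exact Functor.map_isIso (ProObject.mapPro (forget₂ (ModuleCat.{u} R) AddCommGrpCat.{u})) _

variable {R}

instance preservesHomology_preadditiveYoneda_obj_of_injective {C : Type u} [Category.{v} C]
    [Abelian C] (I : C) [Injective I] : (preadditiveYoneda.obj I).PreservesHomology := by
  have := (Injective.injective_iff_preservesEpimorphisms_preadditiveYoneda_obj I).1 inferInstance
  exact Functor.preservesHomology_of_preservesEpis_and_kernels _

/-- For an injective module `I`, there is a natural isomorphism `H^n(X; I) ≅ Hom(H_n(X; R), I)`. -/
noncomputable def cohomologyGroupIsoOfInjective (I : ModuleCat.{u} R) [Injective I] (n : ℕ) :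
    cohomologyGroup I n ≅
      (SSet.homologyFunctor (C := ModuleCat.{u} R) (ModuleCat.of R R) n).op ⋙
        preadditiveYoneda.obj I :=
  let K := ((SSet.chainComplexFunctor (ModuleCat.{u} R)).obj (ModuleCat.of R R)).op
  Functor.isoWhiskerLeft (K ⋙ HomologicalComplex.opFunctor (ModuleCat.{u} R) (ComplexShape.down ℕ) ⋙
      HomologicalComplex.shortComplexFunctor (ModuleCat.{u} R)ᵒᵖ (ComplexShape.up ℕ) n)
    (ShortComplex.homologyFunctorIso (preadditiveYoneda.obj I)) ≪≫
  Functor.isoWhiskerLeft K (Functor.isoWhiskerRight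
    (HomologicalComplex.homologyOpNatIso (ModuleCat.{u} R) (ComplexShape.down ℕ) n)
    (preadditiveYoneda.obj I))

theorem isIso_proCohomology_map_iff_of_injective {X Y : ProSpace.{u}} (f : X ⟶ Y)
    (I : ModuleCat.{u} R) [Injective I] (n : ℕ) :
    IsIso ((proCohomology I n).map f.op) ↔
      Function.Bijective (ProObject.Hom.pull ((ProObject.mapPro
        (SSet.homologyFunctor (C := ModuleCat.{u} R) (ModuleCat.of R R) n)).map f) (c := I)) := by
  rw [← ProObject.isIso_colimitMap_preadditiveYoneda_iff, ProObject.colimitMap_mapPro_map]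
  exact ProObject.isIso_colimitMap_iff_of_iso (cohomologyGroupIsoOfInjective I n) f

theorem isHomologyWeakEquivalence_iff_of_injective {X Y : ProSpace.{u}} (f : X ⟶ Y) :
    IsHomologyWeakEquivalence R f ↔ ∀ (n : ℕ) (I : ModuleCat.{u} R) [Injective I],
      IsIso ((proCohomology I n).map f.op) := by
  refine (isHomologyWeakEquivalence_iff R f).trans (forall_congr' fun n => ?_)
  refine (ProObject.isIso_iff_pull_bijective_of_injective _).trans (forall_congr' fun I => ?_)
  exact forall_congr' fun _ => (isIso_proCohomology_map_iff_of_injective f I n).symm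

/-! ### Long exact sequences in the coefficients -/

/-- The functoriality of cochains with respect to the coefficients. -/
noncomputable def cochainsMap {M N : ModuleCat.{u} R} (g : M ⟶ N) : cochains M ⟶ cochains N :=
  Functor.whiskerLeft _ (Functor.whiskerLeft _
    (NatTrans.mapHomologicalComplex (preadditiveYoneda.map g) _))

/-- The functoriality of cohomology with respect to the coefficients. -/
noncomputable def cohomologyGroupMap {M N : ModuleCat.{u} R} (g : M ⟶ N) (n : ℕ) :
    cohomologyGroup M n ⟶ cohomologyGroup N n :=
  Functor.whiskerRight (cochainsMap g) _

variable (S : ShortComplex (ModuleCat.{u} R))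

/-- The sequence `C^*(X; S.X₁) ⟶ C^*(X; S.X₂) ⟶ C^*(X; S.X₃)`. -/
noncomputable def cochainsShortComplex :
    SSet.{u}ᵒᵖ ⥤ ShortComplex (CochainComplex AddCommGrpCat.{u} ℕ) where
  obj X := ShortComplex.mk ((cochainsMap S.f).app X) ((cochainsMap S.g).app X) (by
    ext n x
    let y : (X.unop.chainComplex (ModuleCat.of R R)).X n ⟶ S.X₁ := x
    have h : (y ≫ S.f) ≫ S.g = 0 := by rw [Category.assoc, S.zero, comp_zero]
    exact h)
  map a :=
    { τ₁ := (cochains S.X₁).map a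
      τ₂ := (cochains S.X₂).map a
      τ₃ := (cochains S.X₃).map a
      comm₁₂ := (cochainsMap S.f).naturality a
      comm₂₃ := (cochainsMap S.g).naturality a }

instance (X : SSet.{u}) (P : ModuleCat.{u} R) [Projective P] (n : ℕ) :
    Projective ((X.chainComplex P).X n) :=
  inferInstanceAs (Projective (∐ fun _ => P))

variable {S} (hS : S.ShortExact)

-- The chain modules are coproducts of copies of `R`, hence projective, so `Hom` out of them is
-- exact.
include hS in
theorem cochainsShortComplex_shortExact (X : SSet.{u}ᵒᵖ) :
    ((cochainsShortComplex S).obj X).ShortExact := by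
  have := hS.mono_f
  have := hS.epi_g
  have : Projective (ModuleCat.of R R) := ModuleCat.projective_of_categoryTheory_projective _
  refine HomologicalComplex.shortExact_of_degreewise_shortExact _ fun n => ?_
  let P := (X.unop.chainComplex (ModuleCat.of R R)).X n
  have h₁ : Function.Injective (fun x : P ⟶ S.X₁ => x ≫ S.f) :=
    fun x y h => (cancel_mono S.f).1 h
  have h₃ : Function.Surjective (fun x : P ⟶ S.X₂ => x ≫ S.g) :=
    fun x => ⟨Projective.factorThru x S.g, Projective.factorThru_comp _ _⟩
  exact
    { exact := (ShortComplex.ab_exact_iff _).2 fun (x : P ⟶ S.X₂) hx =>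
        ⟨hS.exact.lift x hx, hS.exact.lift_f x hx⟩
      mono_f := (AddCommGrpCat.mono_iff_injective _).2 h₁
      epi_g := (AddCommGrpCat.epi_iff_surjective _).2 h₃ }

/-- The connecting homomorphism in cohomology. -/
noncomputable def cohomologyGroupδ (n : ℕ) :
    cohomologyGroup S.X₃ n ⟶ cohomologyGroup S.X₁ (n + 1) where
  app X := (cochainsShortComplex_shortExact hS X).δ n (n + 1) rfl
  naturality _ _ a := (HomologicalComplex.HomologySequence.δ_naturality
    ((cochainsShortComplex S).map a) _ _ n (n + 1) rfl).symm

theorem cohomologyGroup_exact₁ (n : ℕ) (X : SSet.{u}ᵒᵖ) :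
    Function.Exact ((cohomologyGroupδ hS n).app X) ((cohomologyGroupMap S.f (n + 1)).app X) :=
  (ShortComplex.ab_exact_iff_function_exact _).1
    ((cochainsShortComplex_shortExact hS X).homology_exact₁ n (n + 1) rfl)

include hS in
theorem cohomologyGroup_exact₂ (n : ℕ) (X : SSet.{u}ᵒᵖ) :
    Function.Exact ((cohomologyGroupMap S.f n).app X) ((cohomologyGroupMap S.g n).app X) :=
  (ShortComplex.ab_exact_iff_function_exact _).1
    ((cochainsShortComplex_shortExact hS X).homology_exact₂ n)

theorem cohomologyGroup_exact₃ (n : ℕ) (X : SSet.{u}ᵒᵖ) :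
    Function.Exact ((cohomologyGroupMap S.g n).app X) ((cohomologyGroupδ hS n).app X) :=
  (ShortComplex.ab_exact_iff_function_exact _).1
    ((cochainsShortComplex_shortExact hS X).homology_exact₃ n (n + 1) rfl)

-- No differential enters degree `0`, so there cohomology is the group of cocycles, and the map on
-- cocycles is mono.
include hS in
theorem cohomologyGroupMap_zero_injective (X : SSet.{u}ᵒᵖ) :
    Function.Injective ((cohomologyGroupMap S.f 0).app X) := by
  refine (AddCommGrpCat.mono_iff_injective _).1 ?_
  have : Mono ((cochainsMap S.f).app X) := (cochainsShortComplex_shortExact hS X).mono_f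
  change Mono (HomologicalComplex.homologyMap ((cochainsMap S.f).app X) 0)
  have h := HomologicalComplex.homologyπ_naturality ((cochainsMap S.f).app X) 0
  rw [← IsIso.eq_inv_comp] at h
  rw [h]
  infer_instance

variable {X Y : ProSpace.{u}} (f : X ⟶ Y)

/-- The functoriality of the cohomology of pro-spaces with respect to the coefficients. -/
noncomputable def proCohomologyMap {M N : ModuleCat.{u} R} (g : M ⟶ N) (n : ℕ) :
    proCohomology M n ⟶ proCohomology N n :=
  ProObject.colimitFunctorMap (cohomologyGroupMap g n)

/-- The connecting homomorphism in the cohomology of pro-spaces. -/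
noncomputable def proCohomologyδ (n : ℕ) : proCohomology S.X₃ n ⟶ proCohomology S.X₁ (n + 1) :=
  ProObject.colimitFunctorMap (cohomologyGroupδ hS n)

theorem proCohomology_exact₁ (n : ℕ) (X : ProSpace.{u}ᵒᵖ) :
    Function.Exact ((proCohomologyδ hS n).app X).hom ((proCohomologyMap S.f (n + 1)).app X).hom :=
  ProObject.colimitFunctorMap_exact _ _ (cohomologyGroup_exact₁ hS n) X

include hS in
theorem proCohomology_exact₂ (n : ℕ) (X : ProSpace.{u}ᵒᵖ) :
    Function.Exact ((proCohomologyMap S.f n).app X).hom ((proCohomologyMap S.g n).app X).hom :=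
  ProObject.colimitFunctorMap_exact _ _ (cohomologyGroup_exact₂ hS n) X

theorem proCohomology_exact₃ (n : ℕ) (X : ProSpace.{u}ᵒᵖ) :
    Function.Exact ((proCohomologyMap S.g n).app X).hom ((proCohomologyδ hS n).app X).hom :=
  ProObject.colimitFunctorMap_exact _ _ (cohomologyGroup_exact₃ hS n) X

include hS in
theorem proCohomologyMap_zero_injective (X : ProSpace.{u}ᵒᵖ) :
    Function.Injective ((proCohomologyMap S.f 0).app X).hom :=
  ProObject.colimitFunctorMap_injective _ (cohomologyGroupMap_zero_injective hS) X

theorem NatTrans.hom_comp_hom {D : Type*} [Category* D] {F G : D ⥤ AddCommGrpCat.{u}} (α : F ⟶ G)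
    {X Y : D} (f : X ⟶ Y) : (α.app Y).hom.comp (F.map f).hom = (G.map f).hom.comp (α.app X).hom :=
  congrArg AddCommGrpCat.Hom.hom (α.naturality f)

/-! ### Dimension shifting -/

variable {X Y : ProSpace.{u}} (f : X ⟶ Y)

include hS in
theorem proCohomology_map_zero_injective
    (h₂ : Function.Injective ((proCohomology S.X₂ 0).map f.op).hom) :
    Function.Injective ((proCohomology S.X₁ 0).map f.op).hom := by
  have h := h₂.comp (proCohomologyMap_zero_injective hS (op Y))
  rw [← AddMonoidHom.coe_comp, ← NatTrans.hom_comp_hom] at h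
  exact Function.Injective.of_comp h

include hS in
theorem proCohomology_map_zero_surjective
    (h₂ : Function.Surjective ((proCohomology S.X₂ 0).map f.op).hom)
    (h₃ : Function.Injective ((proCohomology S.X₃ 0).map f.op).hom) :
    Function.Surjective ((proCohomology S.X₁ 0).map f.op).hom :=
  AddMonoidHom.surjective_of_surjective_of_injective_of_left_exact _ _ _ _ _ _ _
    (NatTrans.hom_comp_hom (proCohomologyMap S.f 0) f.op)
    (NatTrans.hom_comp_hom (proCohomologyMap S.g 0) f.op)
    (proCohomology_exact₂ hS 0 _) (proCohomology_exact₂ hS 0 _) h₂ h₃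
    (proCohomologyMap_zero_injective hS _)

-- Four lemma on `H^n(S.X₂) → H^n(S.X₃) → H^(n+1)(S.X₁) → H^(n+1)(S.X₂)`.
include hS in
theorem proCohomology_map_succ_injective (n : ℕ)
    (h₂ : Function.Surjective ((proCohomology S.X₂ n).map f.op).hom)
    (h₃ : Function.Injective ((proCohomology S.X₃ n).map f.op).hom)
    (h₂' : Function.Injective ((proCohomology S.X₂ (n + 1)).map f.op).hom) :
    Function.Injective ((proCohomology S.X₁ (n + 1)).map f.op).hom :=
  AddMonoidHom.injective_of_surjective_of_injective_of_injective _ _ _ _ _ _ _ _ _ _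
    (NatTrans.hom_comp_hom (proCohomologyMap S.g n) f.op)
    (NatTrans.hom_comp_hom (proCohomologyδ hS n) f.op)
    (NatTrans.hom_comp_hom (proCohomologyMap S.f (n + 1)) f.op)
    (proCohomology_exact₃ hS n _) (proCohomology_exact₁ hS n _)
    (proCohomology_exact₃ hS n _) h₂ h₃ h₂'

-- Four lemma, one place further along the sequence.
include hS in
theorem proCohomology_map_succ_surjective (n : ℕ)
    (h₃ : Function.Surjective ((proCohomology S.X₃ n).map f.op).hom)
    (h₂' : Function.Surjective ((proCohomology S.X₂ (n + 1)).map f.op).hom)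
    (h₃' : Function.Injective ((proCohomology S.X₃ (n + 1)).map f.op).hom) :
    Function.Surjective ((proCohomology S.X₁ (n + 1)).map f.op).hom :=
  AddMonoidHom.surjective_of_surjective_of_surjective_of_injective _ _ _ _ _ _ _ _ _ _
    (NatTrans.hom_comp_hom (proCohomologyδ hS n) f.op)
    (NatTrans.hom_comp_hom (proCohomologyMap S.f (n + 1)) f.op)
    (NatTrans.hom_comp_hom (proCohomologyMap S.g (n + 1)) f.op)
    (proCohomology_exact₂ hS (n + 1) _) (proCohomology_exact₁ hS n _)
    (proCohomology_exact₂ hS (n + 1) _) h₃ h₂' h₃'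

theorem proCohomology_map_bijective
    (h : ∀ (n : ℕ) (I : ModuleCat.{u} R) [Injective I],
      Function.Bijective ((proCohomology I n).map f.op).hom) (n : ℕ) (M : ModuleCat.{u} R) :
    Function.Bijective ((proCohomology M n).map f.op).hom := by
  have hS (M : ModuleCat.{u} R) : (ShortComplex.mk (Injective.ι M) (cokernel.π (Injective.ι M))
      (cokernel.condition _)).ShortExact :=
    { exact := ShortComplex.exact_cokernel _
      mono_f := Injective.ι_mono M
      epi_g := inferInstanceAs (Epi (cokernel.π _)) }
  induction n generalizing M with
  | zero =>
    have hi (M : ModuleCat.{u} R) := proCohomology_map_zero_injective (hS M) f (h 0 _).1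
    exact ⟨hi M, proCohomology_map_zero_surjective (hS M) f (h 0 _).2 (hi _)⟩
  | succ n ih =>
    -- Injectivity comes first, for all modules at once: surjectivity for `M` needs injectivity for
    -- `I/M` in the same degree.
    have hi (M : ModuleCat.{u} R) :=
      proCohomology_map_succ_injective (hS M) f n (ih _).2 (ih _).1 (h (n + 1) _).1
    exact ⟨hi M, proCohomology_map_succ_surjective (hS M) f n (ih _).2 (h (n + 1) _).2 (hi _)⟩

end

theorem mainTheorem4 (R : Type u) [Ring R] {X Y : ProSpace.{u}} (f : X ⟶ Y) :
    IsHomologyWeakEquivalence R f ↔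
      ∀ (n : ℕ) (M : ModuleCat.{u} R), IsIso ((proCohomology M n).map f.op) := by
  rw [isHomologyWeakEquivalence_iff_of_injective]
  refine ⟨fun h n M => ?_, fun h n I _ => h n I⟩
  exact (ConcreteCategory.isIso_iff_bijective _).2 (proCohomology_map_bijective f
    (fun n I _ => (ConcreteCategory.isIso_iff_bijective _).1 (h n I)) n M)
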